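/- Let $A\in\mathbb C^{n\times n}$, $b,x_0\in\mathbb C^n$, let $r_0=b-Ax_0\neq 0$, let $k\ge 0$, and let $x_k$ be a $k$-th GMRES iterate, i.e. a minimizer of the Euclidean norm $\|b-Ax\|$ over $x\in x_0+\operatorname{span}\{r_0,Ar_0,\dots,A^{k-1}r_0\}$; put $r_k=b-Ax_k$. Let $\|\cdot\|$ also denote the matrix 2-norm. Partition the spectrum $\sigma(A)$ into disjoint sets $\Lambda_1,\dots,\Lambda_m$. Let $P_j=\frac1{2\pi i}\int (zI-A)^{-1}\,dz$ be the spectral projector of $A$ for $\Lambda_j$ (the integral is over a union of small disjoint circles about the points of $\Lambda_j$, enclosing no other eigenvalue), and let the columns of $U_j$ be an orthonormal basis of $\operatorname{Ran}P_j$. Let $\varepsilon>0$, write $B_j=U_j^*AU_j$ and $$\sigma_\varepsilon(B_j)=\{z\in\mathbb C:\ \|(zI-B_j)^{-1}\|>\varepsilon^{-1}\}$$ (the norm being $\infty$ when $z\in\sigma(B_j)$). For each $j$ let $\Gamma_j$ be a rectifiable Jordan curve, or a finite union of rectifiable Jordan curves, enclosing $\sigma_\varepsilon(B_j)$: it is disjoint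 from $\sigma_\varepsilon(B_j)$ and its total winding number about every point of $\sigma_\varepsilon(B_j)$ is $1$. Let $L(\Gamma_j)$ be its length, let $\mathcal P_k$ be the set of complex polynomials of degree at most $k$, and read $\max_{z\in S}|p(z)|$ as a supremum when $S$ is not closed. (a) If $\Gamma_j\subseteq\partial\sigma_\varepsilon(B_j)$ for every $j$, then $$\frac{\|r_k\|}{\|r_0\|}\ \le\ \min_{p\in\mathcal P_k,\ p(0)=1}\ \sum_{j=1}^m \|P_j\|\,\frac{L(\Gamma_j)}{2\pi\varepsilon}\,\max_{z\in\sigma_\varepsilon(B_j)}|p(z)|.$$ (b) For arbitrary $\Gamma_j$ enclosing $\sigma_\varepsilon(B_j)$ (for instance slightly exterior to $\partial\sigma_\varepsilon(B_j)$), $$\frac{\|r_k\|}{\|r_0\|}\ \le\ \min_{p\in\mathcal P_k,\ p(0)=1}\ \sum_{j=1}^m \|P_j\|\,\frac{L(\Gamma_j)}{2\pi\varepsilon}\,\max_{z\in\sigma_\varepsilon(B_j)\cup\Gamma_j}|p(z)|.$$ In both cases the minimum is attained. -/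

import Mathlib

open scoped Matrix.Norms.L2Operator

noncomputable section

/-- The action of a complex matrix on vectors with the Euclidean norm. Throughout, the norm `‖M‖` of
a matrix is the operator norm induced by the Euclidean norms (the matrix 2-norm). -/
def matVec {n : ℕ} (A : Matrix (Fin n) (Fin n) ℂ) (x : EuclideanSpace ℂ (Fin n)) :
    EuclideanSpace ℂ (Fin n) :=
  WithLp.toLp 2 (A.mulVec x.ofLp)

/-- The residual `b - A x`. -/
def axResidual {n : ℕ} (A : Matrix (Fin n) (Fin n) ℂ) (b x : EuclideanSpace ℂ (Fin n)) :
    EuclideanSpace ℂ (Fin n) :=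
  b - matVec A x

/-- The Krylov subspace `span {r, A r, …, A^(k-1) r}`. -/
def krylov {n : ℕ} (A : Matrix (Fin n) (Fin n) ℂ) (r : EuclideanSpace ℂ (Fin n)) (k : ℕ) :
    Submodule ℂ (EuclideanSpace ℂ (Fin n)) :=
  Submodule.span ℂ ((fun i : ℕ => matVec (A ^ i) r) '' Set.Iio k)

/-- `x` is a `k`-th GMRES iterate for `A x = b` with initial guess `x₀`: it minimizes the norm of the
residual over the affine Krylov subspace `x₀ + span {r₀, A r₀, …, A^(k-1) r₀}`, `r₀ = b - A x₀`. -/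
def IsGMRESIterate {n : ℕ} (A : Matrix (Fin n) (Fin n) ℂ) (b x₀ : EuclideanSpace ℂ (Fin n)) (k : ℕ)
    (x : EuclideanSpace ℂ (Fin n)) : Prop :=
  x - x₀ ∈ krylov A (axResidual A b x₀) k ∧
    ∀ y : EuclideanSpace ℂ (Fin n), y - x₀ ∈ krylov A (axResidual A b x₀) k →
      ‖axResidual A b x‖ ≤ ‖axResidual A b y‖

/-- Polynomials of degree at most `k` with `p(0) = 1`. -/
def residualPolys (k : ℕ) : Set (Polynomial ℂ) :=
  {p | p.natDegree ≤ k ∧ p.eval 0 = 1}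

/-- The maximum (supremum, if `S` is not closed) of `|p|` on the set `S`. -/
def supAbs (p : Polynomial ℂ) (S : Set ℂ) : ℝ :=
  sSup ((fun z : ℂ => ‖p.eval z‖) '' S)

/-- The `ε`-pseudospectrum `{z : ‖(z - B)⁻¹‖ > 1/ε}`, the norm being `∞` on the spectrum. -/
def pseudospectrum {d : ℕ} (ε : ℝ) (B : Matrix (Fin d) (Fin d) ℂ) : Set ℂ :=
  {z | z ∈ spectrum ℂ B ∨ ε⁻¹ < ‖(z • (1 : Matrix (Fin d) (Fin d) ℂ) - B)⁻¹‖}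

/-- `P` is the spectral projector of `A` for the set `Λ` of eigenvalues: the integral of
`(2πi)⁻¹ (z - A)⁻¹` over a contour around `Λ` that encloses no other eigenvalue. The contour is a
union of disjoint circles, one about each point of `Λ`; by Cauchy's theorem the value does not depend
on the contour. -/
def IsSpectralProjector {n : ℕ} (A : Matrix (Fin n) (Fin n) ℂ) (Λ : Finset ℂ)
    (P : Matrix (Fin n) (Fin n) ℂ) : Prop :=
  ∃ r : ℂ → ℝ,
    (∀ l ∈ Λ, 0 < r l ∧ ∀ μ ∈ spectrum ℂ A, μ ≠ l → 2 * r l < dist l μ) ∧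
    P = ∑ l ∈ Λ, (2 * (Real.pi : ℂ) * Complex.I)⁻¹ •
      ∮ z in C(l, r l), (z • (1 : Matrix (Fin n) (Fin n) ℂ) - A)⁻¹

/-- A rectifiable Jordan curve, parametrized by `[0, 1]`. -/
structure JordanCurve where
  toFun : ℝ → ℂ
  continuousOn : ContinuousOn toFun (Set.Icc 0 1)
  closed : toFun 0 = toFun 1
  injOn : Set.InjOn toFun (Set.Ico 0 1)
  rectifiable : eVariationOn toFun (Set.Icc 0 1) ≠ ⊤

/-- The set of points on the curve. -/
def JordanCurve.trace (γ : JordanCurve) : Set ℂ := γ.toFun '' Set.Icc 0 1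

/-- The length of the curve. -/
def JordanCurve.length (γ : JordanCurve) : ℝ := (eVariationOn γ.toFun (Set.Icc 0 1)).toReal

/-- The point `w` is off the curve `γ`, and `γ` has winding number `N` about `w`: along the curve
`log (γ - w)` has a continuous branch, which changes by `2πiN`. -/
def JordanCurve.HasWindingNumber (γ : JordanCurve) (w : ℂ) (N : ℤ) : Prop :=
  ∃ θ : ℝ → ℂ, ContinuousOn θ (Set.Icc 0 1) ∧
    (∀ t ∈ Set.Icc (0 : ℝ) 1, Complex.exp (θ t) = γ.toFun t - w) ∧
    θ 1 - θ 0 = 2 * (Real.pi : ℂ) * Complex.I * (N : ℂ)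

/-- A finite union of rectifiable Jordan curves (a single Jordan curve if `num = 1`). -/
structure JordanContour where
  num : ℕ
  curve : Fin num → JordanCurve

/-- The set of points on the contour. -/
def JordanContour.trace (Γ : JordanContour) : Set ℂ := ⋃ i, (Γ.curve i).trace

/-- The total length of the contour. -/
def JordanContour.length (Γ : JordanContour) : ℝ := ∑ i, (Γ.curve i).length

/-- The contour encloses `S`: no point of `S` is on the contour, and the contour winds exactly once
around each point of `S`. For a single Jordan curve this says that the curve is positively oriented
and that `S` is contained in its interior. -/
def JordanContour.Encloses (Γ : JordanContour) (S : Set ℂ) : Prop :=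
  ∀ w ∈ S, ∃ N : Fin Γ.num → ℤ,
    (∀ i, (Γ.curve i).HasWindingNumber w (N i)) ∧ ∑ i, N i = 1

/-- The sum `∑ⱼ ‖Pⱼ‖ · L(Γⱼ)/(2πε) · max_{z ∈ Sⱼ} |p(z)|`. -/
def psaSum {n m : ℕ} (P : Fin m → Matrix (Fin n) (Fin n) ℂ) (ε : ℝ) (Γ : Fin m → JordanContour)
    (S : Fin m → Set ℂ) (p : Polynomial ℂ) : ℝ :=
  ∑ j, ‖P j‖ * ((Γ j).length / (2 * Real.pi * ε)) * supAbs p (S j)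

end

/-! For any admissible `p`, minimality of the iterate gives `‖r_k‖ ≤ ‖p(A)‖ ‖r_0‖`
(`IsGMRESIterate.norm_residual_le`). The projectors sum to the identity (`sum_spectralProjector`),
so `p(A) = ∑ p(A) P_j`. As `P_j` commutes with `A`, its range is invariant, `A U_j = U_j B_j`, and
`‖p(A) P_j‖ ≤ ‖p(B_j)‖ ‖P_j‖` (`norm_aeval_mul_le`). Cauchy's formula for `p(B_j)` over `Γ_j`, where
the resolvent is at most `1/ε`, gives the factor `L(Γ_j)/(2πε)`
(`norm_aeval_le_of_encloses_pseudospectrum`). Idempotence of `P_j` is never needed.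

Cauchy's formula is proved algebraically from the integrals of `(z - a)⁻¹` and its powers, by
partial fractions and Cayley–Hamilton. The axioms in `IsCycleIntegral` serve both the Jordan
contours and the circles defining the `P_j`.

The minimum exists because the right-hand side is a seminorm in `p`, restricted to a
finite-dimensional affine space. -/

/-! ### Cycle integrals of resolvents, from axioms -/

/-- A linear relation `H` between functions and values behaves like integration over a cycle that
avoids `σ` and whose winding number about each point of `σ` is `c / (2πi)`. -/
structure IsCycleIntegral (H : Submodule ℂ ((ℂ → ℂ) × ℂ)) (σ : Set ℂ) (c : ℂ) : Prop where
  congr : ∀ f g : ℂ → ℂ, ∀ I, (∀ z ∉ σ, f z = g z) → (f, I) ∈ H → (g, I) ∈ H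
  inv_sub : ∀ a ∈ σ, ((fun z => (z - a)⁻¹), c) ∈ H
  inv_sub_pow : ∀ a ∈ σ, ∀ k : ℕ, ((fun z => ((z - a)⁻¹) ^ (k + 2)), 0) ∈ H

/-- Partial fractions: two distinct points `a`, `b` let the product be written as `(a - b)⁻¹` times
a difference of products with one factor fewer. These have equal integrals, both `c` or both `0`. If
all points coincide, the product is a pure power. -/
theorem IsCycleIntegral.prod_inv_sub {H : Submodule ℂ ((ℂ → ℂ) × ℂ)} {σ : Set ℂ} {c : ℂ}
    (h : IsCycleIntegral H σ c) (s : Multiset ℂ) (hs : ∀ a ∈ s, a ∈ σ) (hcard : 2 ≤ s.card) :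
    ((fun z => (s.map fun a => (z - a)⁻¹).prod), 0) ∈ H := by
  induction hn : s.card using Nat.strong_induction_on generalizing s with
  | _ n ih =>
  subst hn
  obtain ⟨a, ha⟩ : ∃ a, a ∈ s := Multiset.card_pos_iff_exists_mem.1 (by omega)
  by_cases hall : ∀ b ∈ s, b = a
  · obtain ⟨k, hk⟩ := Nat.exists_eq_add_of_le' hcard
    have hrep : s = Multiset.replicate (k + 2) a := by
      rw [← hk]; exact Multiset.eq_replicate_card.2 hall
    have := h.inv_sub_pow a (hs a ha) k
    rw [hrep]
    simpa only [Multiset.map_replicate, Multiset.prod_replicate] using this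
  · push Not at hall
    obtain ⟨b, hb, hba⟩ := hall
    obtain ⟨s', rfl⟩ := Multiset.exists_cons_of_mem ha
    have hb' : b ∈ s' := by
      rcases Multiset.mem_cons.1 hb with h | h
      · exact absurd h hba
      · exact h
    obtain ⟨t, rfl⟩ := Multiset.exists_cons_of_mem hb'
    have key : ∀ I J : ℂ, ((fun z => ((a ::ₘ t).map fun a => (z - a)⁻¹).prod), I) ∈ H →
        ((fun z => ((b ::ₘ t).map fun a => (z - a)⁻¹).prod), J) ∈ H → I = J →
        ((fun z => ((a ::ₘ b ::ₘ t).map fun a => (z - a)⁻¹).prod), 0) ∈ H := by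
      rintro I J hI hJ rfl
      have := H.smul_mem (a - b)⁻¹ (H.sub_mem hI hJ)
      simp only [Prod.mk_sub_mk, Prod.smul_mk, sub_self, smul_zero] at this
      refine h.congr _ _ _ (fun z hz => ?_) this
      have hza : z - a ≠ 0 := sub_ne_zero.2 fun e => hz (e ▸ hs a ha)
      have hzb : z - b ≠ 0 := sub_ne_zero.2 fun e => hz (e ▸ hs b hb)
      have hab : a - b ≠ 0 := sub_ne_zero.2 (Ne.symm hba)
      simp only [Pi.smul_apply, Pi.sub_apply, Multiset.map_cons, Multiset.prod_cons, smul_eq_mul]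
      field_simp
      ring
    rcases Multiset.empty_or_exists_mem t with rfl | ⟨e, he⟩
    · refine key c c ?_ ?_ rfl
      · simpa using h.inv_sub a (hs a ha)
      · simpa using h.inv_sub b (hs b hb)
    · have : 1 ≤ t.card := Multiset.card_pos_iff_exists_mem.2 ⟨e, he⟩
      refine key 0 0 (ih _ ?_ _ ?_ ?_ rfl) (ih _ ?_ _ ?_ ?_ rfl) rfl
      all_goals first
        | (simp; done)
        | (simp; omega)
        | (intro x hx; apply hs; simp only [Multiset.mem_cons] at hx ⊢; tauto)

/-- The matrix function `F` is related to the matrix `M` by `H`, entry by entry. -/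
def EntrywiseMem {d : ℕ} (H : Submodule ℂ ((ℂ → ℂ) × ℂ)) (F : ℂ → Matrix (Fin d) (Fin d) ℂ)
    (M : Matrix (Fin d) (Fin d) ℂ) : Prop :=
  ∀ i j, ((fun z => F z i j), M i j) ∈ H

section EntrywiseMem

variable {d : ℕ} {H : Submodule ℂ ((ℂ → ℂ) × ℂ)} {F G : ℂ → Matrix (Fin d) (Fin d) ℂ}
  {M N : Matrix (Fin d) (Fin d) ℂ}

theorem EntrywiseMem.add (hF : EntrywiseMem H F M) (hG : EntrywiseMem H G N) :
    EntrywiseMem H (fun z => F z + G z) (M + N) :=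
  fun i j => H.add_mem (hF i j) (hG i j)

theorem EntrywiseMem.smul (hF : EntrywiseMem H F M) (a : ℂ) :
    EntrywiseMem H (fun z => a • F z) (a • M) :=
  fun i j => H.smul_mem a (hF i j)

theorem EntrywiseMem.const_mul (hF : EntrywiseMem H F M) (C : Matrix (Fin d) (Fin d) ℂ) :
    EntrywiseMem H (fun z => C * F z) (C * M) := by
  intro i j
  have := H.sum_mem (t := Finset.univ) fun l _ => H.smul_mem (C i l) (hF l j)
  convert this using 1
  ext <;> simp [Matrix.mul_apply, Prod.fst_sum, Prod.snd_sum]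

theorem EntrywiseMem.smul_const {f : ℂ → ℂ} {I : ℂ} (hf : (f, I) ∈ H)
    (C : Matrix (Fin d) (Fin d) ℂ) : EntrywiseMem H (fun z => f z • C) (I • C) := by
  intro i j
  have := H.smul_mem (C i j) hf
  convert this using 1
  ext <;> simp [mul_comm]

theorem EntrywiseMem.congr {σ : Set ℂ} {c : ℂ} (h : IsCycleIntegral H σ c)
    (hF : EntrywiseMem H F M) (hFG : ∀ z ∉ σ, F z = G z) : EntrywiseMem H G M :=
  fun i j => h.congr _ _ _ (fun z hz => by rw [hFG z hz]) (hF i j)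

theorem isUnit_smul_one_sub {B : Matrix (Fin d) (Fin d) ℂ} {z : ℂ} (hz : z ∉ spectrum ℂ B) :
    IsUnit (z • (1 : Matrix (Fin d) (Fin d) ℂ) - B) := by
  rw [spectrum.notMem_iff, Algebra.algebraMap_eq_smul_one] at hz
  exact hz

theorem smul_one_sub_mul_inv {B : Matrix (Fin d) (Fin d) ℂ} {z : ℂ} (hz : z ∉ spectrum ℂ B) :
    (z • (1 : Matrix (Fin d) (Fin d) ℂ) - B) * (z • (1 : Matrix (Fin d) (Fin d) ℂ) - B)⁻¹ = 1 :=
  Matrix.mul_nonsing_inv _ ((Matrix.isUnit_iff_isUnit_det _).1 (isUnit_smul_one_sub hz))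

theorem smul_inv_eq {B : Matrix (Fin d) (Fin d) ℂ} {z : ℂ} (hz : z ∉ spectrum ℂ B) :
    z • (z • (1 : Matrix (Fin d) (Fin d) ℂ) - B)⁻¹ =
      1 + B * (z • (1 : Matrix (Fin d) (Fin d) ℂ) - B)⁻¹ := by
  have := smul_one_sub_mul_inv hz
  rw [sub_mul, smul_mul_assoc, one_mul] at this
  exact eq_add_of_sub_eq this

-- Since `(B - a) R = (z - a) R - 1`, adjoining `a` to `s` adds a scalar product of inverses times a
-- constant matrix. The first such term has one factor and contributes `c`; the later ones have at
-- least two and contribute nothing.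
open Polynomial in
theorem IsCycleIntegral.resolvent_sub_prod {B : Matrix (Fin d) (Fin d) ℂ} {σ : Set ℂ} {c : ℂ}
    (h : IsCycleIntegral H σ c) (hσ : spectrum ℂ B ⊆ σ) (s : Multiset ℂ) (hs : ∀ a ∈ s, a ∈ σ) :
    EntrywiseMem H (fun z => (z • (1 : Matrix (Fin d) (Fin d) ℂ) - B)⁻¹ -
      (s.map fun a => (z - a)⁻¹).prod • (aeval B (s.map fun a => X - C a).prod *
        (z • (1 : Matrix (Fin d) (Fin d) ℂ) - B)⁻¹)) (if s = 0 then 0 else c • 1) := by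
  induction s using Multiset.induction with
  | empty =>
    intro i j
    have := H.zero_mem
    rw [Prod.zero_eq_mk] at this
    simpa [Pi.zero_def] using this
  | cons a s ih =>
    have ih := ih fun b hb => hs b (Multiset.mem_cons_of_mem hb)
    have hmem : ((fun z => ((a ::ₘ s).map fun a => (z - a)⁻¹).prod), if s = 0 then c else 0) ∈ H := by
      split_ifs with h0
      · subst h0
        simpa using h.inv_sub a (hs a (Multiset.mem_cons_self a _))
      · refine h.prod_inv_sub _ hs ?_
        have := Multiset.card_pos.2 h0
        simp; omega
    have := ih.add (EntrywiseMem.smul_const hmem (aeval B (s.map fun a => X - C a).prod))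
    have hval : ((if s = 0 then 0 else c • 1) + (if s = 0 then c else 0) •
        aeval B (s.map fun a => X - C a).prod : Matrix (Fin d) (Fin d) ℂ) = c • 1 := by
      split_ifs with h0
      · simp [h0]
      · simp
    rw [hval] at this
    rw [if_neg Multiset.cons_ne_zero]
    refine this.congr h fun z hz => ?_
    have hza : z - a ≠ 0 := sub_ne_zero.2 fun e => hz (e ▸ hs a (Multiset.mem_cons_self a _))
    have hR := smul_inv_eq fun hzB => hz (hσ hzB)
    set R := (z • (1 : Matrix (Fin d) (Fin d) ℂ) - B)⁻¹
    simp only [Multiset.map_cons, Multiset.prod_cons]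
    rw [mul_comm (X - C a), map_mul, mul_assoc]
    set Q := aeval B (s.map fun a => X - C a).prod
    set w := (s.map fun a => (z - a)⁻¹).prod
    have hBR : (aeval B (X - C a)) * R = (z - a) • R - 1 := by
      simp only [map_sub, aeval_X, aeval_C, Algebra.algebraMap_eq_smul_one, sub_mul, sub_smul, hR,
        smul_mul_assoc, one_mul]
      abel
    rw [hBR, mul_sub, mul_one, mul_smul_comm, smul_sub, smul_smul]
    have : (z - a)⁻¹ * w * (z - a) = w := by field_simp
    rw [this]
    abel

-- With `s` the roots of the characteristic polynomial, Cayley–Hamilton kills the subtracted term of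
-- `resolvent_sub_prod`.
open Polynomial in
theorem IsCycleIntegral.resolvent {B : Matrix (Fin d) (Fin d) ℂ} {σ : Set ℂ} {c : ℂ}
    (h : IsCycleIntegral H σ c) (hσ : spectrum ℂ B ⊆ σ) :
    EntrywiseMem H (fun z => (z • (1 : Matrix (Fin d) (Fin d) ℂ) - B)⁻¹) (c • 1) := by
  intro i j
  -- An entry exists, so `d > 0` and the multiset of roots is nonempty.
  have hd : 0 < d := i.pos
  have hroots : ∀ a ∈ B.charpoly.roots, a ∈ σ := fun a ha => hσ <| by
    rw [Matrix.mem_spectrum_iff_isRoot_charpoly]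
    exact (mem_roots'.1 ha).2
  have hsplit : B.charpoly.Splits := IsAlgClosed.splits _
  have hprod := hsplit.eq_prod_roots_of_monic B.charpoly_monic
  have hne : B.charpoly.roots ≠ 0 := by
    intro h0
    rw [h0] at hprod
    have := B.charpoly_natDegree_eq_dim
    rw [hprod] at this
    simp at this
    omega
  have := h.resolvent_sub_prod hσ _ hroots
  rw [← hprod, if_neg hne] at this
  simpa [Matrix.aeval_self_charpoly] using this i j

-- Induction on the power through `z R = 1 + B R`: the term without resolvent is a power of `z`,
-- whose integral is zero.
open Polynomial in
theorem IsCycleIntegral.eval_smul_resolvent {B : Matrix (Fin d) (Fin d) ℂ} {σ : Set ℂ} {c : ℂ}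
    (h : IsCycleIntegral H σ c) (hσ : spectrum ℂ B ⊆ σ)
    (hpow : ∀ k : ℕ, ((fun z => z ^ k), (0 : ℂ)) ∈ H) (p : ℂ[X]) :
    EntrywiseMem H (fun z => p.eval z • (z • (1 : Matrix (Fin d) (Fin d) ℂ) - B)⁻¹)
      (c • aeval B p) := by
  have hmon : ∀ k : ℕ, EntrywiseMem H
      (fun z => z ^ k • (z • (1 : Matrix (Fin d) (Fin d) ℂ) - B)⁻¹) (c • B ^ k) := by
    intro k
    induction k with
    | zero => simpa using h.resolvent hσ
    | succ k ih =>
      have := (EntrywiseMem.smul_const (hpow k) (1 : Matrix (Fin d) (Fin d) ℂ)).add (ih.const_mul B)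
      rw [zero_smul, zero_add, mul_smul_comm, ← pow_succ'] at this
      refine this.congr h fun z hz => ?_
      rw [pow_succ, mul_smul, smul_inv_eq fun hzB => hz (hσ hzB), smul_add, mul_smul_comm]
  induction p using Polynomial.induction_on' with
  | add p q hp hq =>
    simpa only [eval_add, add_smul, map_add, smul_add] using hp.add hq
  | monomial k a =>
    have := (hmon k).smul a
    simp only [smul_smul] at this
    simpa [aeval_monomial, Algebra.algebraMap_eq_smul_one, smul_smul, mul_comm] using this

end EntrywiseMem

/-! ### Riemann–Stieltjes sums along rectifiable curves -/

open Filter Topology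

/-- The left Riemann–Stieltjes sum of `f` along the curve `γ` for the uniform partition of `[0, 1]`
into `N` intervals. -/
noncomputable def riemannSum (γ : ℝ → ℂ) (N : ℕ) (f : ℂ → ℂ) : ℂ :=
  ∑ i ∈ Finset.range N, (γ (((i + 1 : ℕ) : ℝ) / N) - γ ((i : ℝ) / N)) * f (γ ((i : ℝ) / N))

theorem sum_norm_sub_le_variation {γ : ℝ → ℂ} (hγ : eVariationOn γ (Set.Icc 0 1) ≠ ⊤) (N : ℕ) :
    ∑ i ∈ Finset.range N, ‖γ (((i + 1 : ℕ) : ℝ) / N) - γ ((i : ℝ) / N)‖ ≤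
      (eVariationOn γ (Set.Icc 0 1)).toReal := by
  have h := eVariationOn.sum_le_of_monotoneOn_Iic (f := γ) (s := Set.Icc (0 : ℝ) 1) (n := N)
    (u := fun i : ℕ => (i : ℝ) / N)
    (fun i _ j _ hij => by
      have : (i : ℝ) ≤ j := by exact_mod_cast hij
      simp only
      gcongr)
    (fun i hi => ⟨by positivity, by
      have : (i : ℝ) ≤ N := by exact_mod_cast hi
      exact div_le_one_of_le₀ this (by positivity)⟩)
  have h2 := ENNReal.toReal_mono hγ h
  rw [ENNReal.toReal_sum fun _ _ => edist_ne_top _ _] at h2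
  refine le_of_eq_of_le (Finset.sum_congr rfl fun i _ => ?_) h2
  rw [edist_dist, ENNReal.toReal_ofReal dist_nonneg, dist_eq_norm]

/-- The fundamental theorem of calculus. `Φ` need only agree locally with a primitive along the
curve, which admits continuous branches of a logarithm. -/
theorem tendsto_riemannSum {γ Φ : ℝ → ℂ} {f : ℂ → ℂ} (hγ : ContinuousOn γ (Set.Icc 0 1))
    (hvar : eVariationOn γ (Set.Icc 0 1) ≠ ⊤)
    (hf : ∀ t ∈ Set.Icc (0 : ℝ) 1, ContinuousAt f (γ t))
    (hΦ : ∀ t ∈ Set.Icc (0 : ℝ) 1, ∃ G : ℂ → ℂ, HasStrictDerivAt G (f (γ t)) (γ t) ∧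
      ∀ᶠ s in 𝓝[Set.Icc 0 1] t, Φ s = G (γ s)) :
    Tendsto (fun N => riemannSum γ N f) atTop (𝓝 (Φ 1 - Φ 0)) := by
  set L := (eVariationOn γ (Set.Icc 0 1)).toReal
  have hL : 0 ≤ L := ENNReal.toReal_nonneg
  rw [Metric.tendsto_atTop]
  intro ε hε
  -- `L + 1` avoids division by zero for a constant curve and still gives `η * L < ε`.
  set η := ε / (2 * (L + 1)) with hη
  have hηpos : 0 < η := by positivity
  have hloc : ∀ t ∈ Set.Icc (0 : ℝ) 1, ∀ᶠ s in 𝓝[Set.Icc 0 1] t ×ˢ 𝓝[Set.Icc 0 1] t,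
      ‖Φ s.2 - Φ s.1 - (γ s.2 - γ s.1) * f (γ s.1)‖ ≤ η * ‖γ s.2 - γ s.1‖ := by
    intro t ht
    obtain ⟨G, hG, hΦG⟩ := hΦ t ht
    have hcont := hγ t ht
    -- Strict differentiability is what allows both endpoints of a subinterval to vary near `t`.
    have h1 : ∀ᶠ p in 𝓝 (γ t, γ t), ‖G p.1 - G p.2 - (p.1 - p.2) * f (γ t)‖ ≤
        η / 2 * ‖p.1 - p.2‖ := by
      have := hG.isLittleO.def (half_pos hηpos)
      simpa using this
    have h2 := (Filter.Tendsto.prodMk_nhds (hcont.tendsto.comp tendsto_snd)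
      (hcont.tendsto.comp (tendsto_fst (f := 𝓝[Set.Icc 0 1] t) (g := 𝓝[Set.Icc 0 1] t)))).eventually h1
    have h3 : ∀ᶠ s in 𝓝[Set.Icc 0 1] t, ‖f (γ s) - f (γ t)‖ < η / 2 := by
      have := ((hf t ht).tendsto.comp hcont).eventually (Metric.ball_mem_nhds _ (half_pos hηpos))
      simpa [dist_eq_norm] using this
    filter_upwards [h2, tendsto_fst.eventually hΦG, tendsto_snd.eventually hΦG,
      tendsto_fst.eventually h3] with s hs h4 h5 h6
    simp only [Function.comp] at hs
    rw [h4, h5]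
    calc _ = ‖(G (γ s.2) - G (γ s.1) - (γ s.2 - γ s.1) * f (γ t)) -
            (γ s.2 - γ s.1) * (f (γ s.1) - f (γ t))‖ := by ring_nf
      _ ≤ η / 2 * ‖γ s.2 - γ s.1‖ + ‖γ s.2 - γ s.1‖ * (η / 2) := by
        refine (norm_sub_le _ _).trans (add_le_add hs ?_)
        rw [norm_mul]
        gcongr
      _ = _ := by ring
  have hball : ∀ t ∈ Set.Icc (0 : ℝ) 1, ∃ c ∈ 𝓝[Set.Icc 0 1] t, ∀ s ∈ c, ∀ s' ∈ c,
      ‖Φ s' - Φ s - (γ s' - γ s) * f (γ s)‖ ≤ η * ‖γ s' - γ s‖ := by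
    intro t ht
    obtain ⟨c, hc, hc'⟩ := Filter.mem_prod_same_iff.1 (hloc t ht)
    exact ⟨c, hc, fun s hs s' hs' => hc' (Set.mk_mem_prod hs hs')⟩
  choose! c hc hcs using hball
  -- A Lebesgue number makes the local estimate uniform: once `1 / N < δ`, consecutive nodes lie in
  -- a common `c y`.
  obtain ⟨δ, hδ, hδc⟩ := Metric.uniformity_basis_dist.lebesgue_number_lemma_nhdsWithin'
    (U := fun x _ => c x) isCompact_Icc hc
  obtain ⟨N₀, hN₀⟩ := exists_nat_gt (1 / δ)
  refine ⟨N₀ + 1, fun N hN => ?_⟩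
  have hNpos : (0 : ℝ) < N := by exact_mod_cast (by omega : 0 < N)
  have hmem : ∀ i : ℕ, i ≤ N → (i : ℝ) / N ∈ Set.Icc (0 : ℝ) 1 := fun i hi =>
    ⟨by positivity, div_le_one_of_le₀ (by exact_mod_cast hi) hNpos.le⟩
  have htel : Φ 1 - Φ 0 = ∑ i ∈ Finset.range N, (Φ (((i + 1 : ℕ) : ℝ) / N) - Φ ((i : ℝ) / N)) := by
    rw [Finset.sum_range_sub (fun i : ℕ => Φ ((i : ℝ) / N))]
    simp [hNpos.ne']
  rw [dist_comm, dist_eq_norm, htel, riemannSum, ← Finset.sum_sub_distrib]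
  calc _ ≤ ∑ i ∈ Finset.range N, η * ‖γ (((i + 1 : ℕ) : ℝ) / N) - γ ((i : ℝ) / N)‖ := by
        refine norm_sum_le_of_le _ fun i hi => ?_
        have hi := Finset.mem_range.1 hi
        obtain ⟨⟨y, hy⟩, hyc⟩ := hδc _ (hmem i hi.le)
        refine hcs y hy _ (hyc ⟨?_, hmem i hi.le⟩) _ (hyc ⟨?_, hmem (i + 1) hi⟩)
        · simp [UniformSpace.ball, hδ]
        · have : 1 / δ < N := hN₀.trans (by exact_mod_cast (by omega : N₀ < N))
          have h1 : 1 / (N : ℝ) < δ := by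
            rw [div_lt_iff₀ hδ] at this
            rw [div_lt_iff₀ hNpos]; linarith
          have h2 : ((i + 1 : ℕ) : ℝ) / N - (i : ℝ) / N = 1 / N := by
            push_cast; ring
          simp only [UniformSpace.ball, Set.mem_preimage, Set.mem_ofPred_eq]
          rw [dist_comm, Real.dist_eq, h2, abs_of_pos (by positivity)]
          exact h1
    _ ≤ η * L := by
        rw [← Finset.mul_sum]
        exact mul_le_mul_of_nonneg_left (sum_norm_sub_le_variation hvar N) hηpos.le
    _ < ε := by
        rw [hη, div_mul_eq_mul_div, div_lt_iff₀ (by positivity)]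
        nlinarith

theorem JordanCurve.tendsto_riemannSum_of_hasDerivAt (γ : JordanCurve) {F f : ℂ → ℂ}
    {U : Set ℂ} (hU : IsOpen U) (hγU : γ.trace ⊆ U) (hF : ∀ z ∈ U, HasDerivAt F (f z) z)
    (hf : ∀ z ∈ U, ContinuousAt f z) :
    Tendsto (fun N => riemannSum γ.toFun N f) atTop (𝓝 0) := by
  have := tendsto_riemannSum (Φ := fun t => F (γ.toFun t)) γ.continuousOn γ.rectifiable
    (fun t ht => hf _ (hγU ⟨t, ht, rfl⟩))
    (fun t ht => ⟨F, hasStrictDerivAt_of_hasDerivAt_of_continuousAt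
      (Filter.eventually_of_mem (hU.mem_nhds (hγU ⟨t, ht, rfl⟩)) hF) (hf _ (hγU ⟨t, ht, rfl⟩)),
      Filter.Eventually.of_forall fun _ => rfl⟩)
  simpa [γ.closed] using this

theorem JordanCurve.tendsto_riemannSum_inv_sub (γ : JordanCurve) {w : ℂ} {N : ℤ}
    (h : γ.HasWindingNumber w N) :
    Tendsto (fun n => riemannSum γ.toFun n fun z => (z - w)⁻¹) atTop
      (𝓝 (2 * (Real.pi : ℂ) * Complex.I * N)) := by
  obtain ⟨θ, hθ, hexp, hN⟩ := h
  have hne : ∀ t ∈ Set.Icc (0 : ℝ) 1, γ.toFun t - w ≠ 0 := fun t ht =>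
    hexp t ht ▸ Complex.exp_ne_zero _
  rw [← hN]
  refine tendsto_riemannSum γ.continuousOn γ.rectifiable
    (fun t ht => (continuousAt_id.sub continuousAt_const).inv₀ (hne t ht)) fun t ht => ?_
  -- The local primitive is the principal logarithm, normalized at `γ t` so that its argument stays
  -- near `1`, away from the cut.
  refine ⟨fun z => θ t + Complex.log ((z - w) / (γ.toFun t - w)), ?_, ?_⟩
  · have h1 : HasStrictDerivAt (fun z : ℂ => (z - w) / (γ.toFun t - w)) (1 / (γ.toFun t - w))
        (γ.toFun t) :=
      HasStrictDerivAt.div_const ((hasStrictDerivAt_id _).sub_const w) _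
    have h2 := h1.clog (by rw [div_self (hne t ht)]; exact Complex.one_mem_slitPlane)
    rw [div_self (hne t ht), div_one, one_div] at h2
    exact h2.const_add _
  -- Since `1 < π`, the increment of `θ` stays in the strip where `log` inverts `exp`.
  · have : ∀ᶠ s in 𝓝[Set.Icc 0 1] t, ‖θ s - θ t‖ < 1 := by
      have := (hθ t ht).eventually (Metric.ball_mem_nhds _ one_pos)
      simpa [dist_eq_norm] using this
    filter_upwards [this, self_mem_nhdsWithin] with s hs hsI
    have him : |(θ s - θ t).im| < Real.pi :=
      (Complex.abs_im_le_norm _).trans_lt (hs.trans (by linarith [Real.pi_gt_three]))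
    rw [← hexp s hsI, ← hexp t ht, ← Complex.exp_sub,
      Complex.log_exp (abs_lt.1 him).1 (abs_lt.1 him).2.le]
    ring

/-! ### Cauchy's integral formula over a Jordan contour -/

namespace JordanContour

/-- The pairs of a function and the limit of its Riemann sums along the contour. -/
def integralRelation (Γ : JordanContour) : Submodule ℂ ((ℂ → ℂ) × ℂ) where
  carrier := {q | Tendsto (fun N => ∑ i, riemannSum (Γ.curve i).toFun N q.1) atTop (𝓝 q.2)}
  add_mem' := by
    intro p q hp hq
    have := Tendsto.add hp hq
    simpa [riemannSum, mul_add, Finset.sum_add_distrib] using this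
  zero_mem' := by simp [riemannSum]
  smul_mem' := by
    intro a q hq
    have := Tendsto.const_mul a hq
    simpa [riemannSum, Finset.mul_sum, mul_left_comm] using this

theorem mem_integralRelation {Γ : JordanContour} {f : ℂ → ℂ} {I : ℂ} :
    (f, I) ∈ Γ.integralRelation ↔
      Tendsto (fun N => ∑ i, riemannSum (Γ.curve i).toFun N f) atTop (𝓝 I) := Iff.rfl

theorem mem_integralRelation_of_hasDerivAt (Γ : JordanContour) {F f : ℂ → ℂ}
    {U : Set ℂ} (hU : IsOpen U) (hΓU : Γ.trace ⊆ U) (hF : ∀ z ∈ U, HasDerivAt F (f z) z)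
    (hf : ∀ z ∈ U, ContinuousAt f z) : (f, 0) ∈ Γ.integralRelation := by
  rw [mem_integralRelation]
  have := tendsto_finsetSum (f := fun i N => riemannSum (Γ.curve i).toFun N f) Finset.univ
    fun i _ => (Γ.curve i).tendsto_riemannSum_of_hasDerivAt hU
      ((Set.subset_iUnion (fun i => (Γ.curve i).trace) i).trans hΓU) hF hf
  simpa using this

theorem Encloses.mono {Γ : JordanContour} {S T : Set ℂ} (h : Γ.Encloses T) (hST : S ⊆ T) :
    Γ.Encloses S := fun w hw => h w (hST hw)

theorem Encloses.disjoint_trace {Γ : JordanContour} {S : Set ℂ} (h : Γ.Encloses S) :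
    Disjoint S Γ.trace := by
  rw [Set.disjoint_left]
  rintro w hw hmem
  obtain ⟨i, t, ht, rfl⟩ := Set.mem_iUnion.1 hmem
  obtain ⟨N, hN, -⟩ := h _ hw
  obtain ⟨θ, -, hexp, -⟩ := hN i
  exact Complex.exp_ne_zero (θ t) (by rw [hexp t ht, sub_self])

theorem node_mem_trace (Γ : JordanContour) (i : Fin Γ.num) {N l : ℕ} (hl : l ∈ Finset.range N) :
    (Γ.curve i).toFun ((l : ℝ) / N) ∈ Γ.trace := by
  refine Set.mem_iUnion.2 ⟨i, (l : ℝ) / N, ⟨by positivity, ?_⟩, rfl⟩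
  exact div_le_one_of_le₀ (by exact_mod_cast (Finset.mem_range.1 hl).le) (by positivity)

/-- The simple poles are counted by the winding numbers, which total one; higher powers have a
primitive off `a`. -/
theorem Encloses.isCycleIntegral {Γ : JordanContour} {S : Set ℂ} (h : Γ.Encloses S) :
    IsCycleIntegral Γ.integralRelation S (2 * (Real.pi : ℂ) * Complex.I) where
  congr f g I hfg hf := by
    rw [mem_integralRelation] at hf ⊢
    refine hf.congr fun N => Finset.sum_congr rfl fun i _ => Finset.sum_congr rfl fun l hl => ?_
    rw [hfg _ fun hS => Set.disjoint_left.1 h.disjoint_trace hS (Γ.node_mem_trace i hl)]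
  inv_sub a ha := by
    obtain ⟨N, hN, hsum⟩ := h a ha
    rw [mem_integralRelation]
    have := tendsto_finsetSum (f := fun i n => riemannSum (Γ.curve i).toFun n fun z => (z - a)⁻¹)
      Finset.univ fun i _ => (Γ.curve i).tendsto_riemannSum_inv_sub (hN i)
    rw [← Finset.mul_sum, ← Int.cast_sum, hsum] at this
    simpa using this
  inv_sub_pow a ha k := by
    refine Γ.mem_integralRelation_of_hasDerivAt
      (F := fun z => -(k + 1 : ℂ)⁻¹ * ((z - a)⁻¹) ^ (k + 1)) (U := {a}ᶜ)
      isOpen_compl_singleton ?_ ?_ ?_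
    · rintro z hz rfl
      exact Set.disjoint_left.1 h.disjoint_trace ha hz
    · intro z hz
      have hz : z - a ≠ 0 := sub_ne_zero.2 hz
      have hk : (k + 1 : ℂ) ≠ 0 := by exact_mod_cast k.succ_ne_zero
      have := ((((hasDerivAt_id z).sub_const a).inv hz).pow (k + 1)).const_mul (-(k + 1 : ℂ)⁻¹)
      refine this.congr_deriv ?_
      simp only [Pi.inv_apply, id, Nat.add_sub_cancel, inv_pow]
      push_cast
      field_simp
      ring
    · intro z hz
      exact ((continuousAt_id.sub continuousAt_const).inv₀ (sub_ne_zero.2 hz)).pow _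

theorem pow_mem_integralRelation (Γ : JordanContour) (k : ℕ) :
    ((fun z => z ^ k), (0 : ℂ)) ∈ Γ.integralRelation := by
  refine Γ.mem_integralRelation_of_hasDerivAt (F := fun z => (k + 1 : ℂ)⁻¹ * z ^ (k + 1))
    isOpen_univ (Set.subset_univ _) (fun z _ => ?_) fun z _ => continuousAt_id.pow k
  have hk : (k + 1 : ℂ) ≠ 0 := by exact_mod_cast k.succ_ne_zero
  have := (hasDerivAt_pow (k + 1) z).const_mul ((k + 1 : ℂ)⁻¹)
  refine this.congr_deriv ?_
  push_cast
  simp [inv_mul_cancel_left₀ hk]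

/-- Cauchy's integral formula gives a bound on a polynomial of a matrix. -/
theorem Encloses.norm_aeval_le {d : ℕ} {Γ : JordanContour} {B : Matrix (Fin d) (Fin d) ℂ}
    (h : Γ.Encloses (spectrum ℂ B)) {C K : ℝ}
    (hC : ∀ z ∈ Γ.trace, ‖(z • (1 : Matrix (Fin d) (Fin d) ℂ) - B)⁻¹‖ ≤ C)
    (p : Polynomial ℂ) (hpK : ∀ z ∈ Γ.trace, ‖p.eval z‖ ≤ K) :
    ‖Polynomial.aeval B p‖ ≤ Γ.length / (2 * Real.pi) * C * K := by
  set F : ℂ → Matrix (Fin d) (Fin d) ℂ :=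
    fun z => p.eval z • (z • (1 : Matrix (Fin d) (Fin d) ℂ) - B)⁻¹ with hFdef
  have hmem := h.isCycleIntegral.eval_smul_resolvent subset_rfl Γ.pow_mem_integralRelation p
  set S : ℕ → Matrix (Fin d) (Fin d) ℂ := fun N => ∑ i, ∑ l ∈ Finset.range N,
    ((Γ.curve i).toFun (((l + 1 : ℕ) : ℝ) / N) - (Γ.curve i).toFun ((l : ℝ) / N)) •
      F ((Γ.curve i).toFun ((l : ℝ) / N)) with hS
  have hlim : Tendsto S atTop (𝓝 ((2 * (Real.pi : ℂ) * Complex.I) • Polynomial.aeval B p)) := by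
    refine tendsto_pi_nhds.2 fun a => tendsto_pi_nhds.2 fun b => ?_
    refine (mem_integralRelation.1 (hmem a b)).congr fun N => ?_
    simp [hS, hFdef, riemannSum, Matrix.sum_apply]
  have hFle : ∀ z ∈ Γ.trace, ‖F z‖ ≤ C * K := fun z hz => by
    rw [hFdef, norm_smul, mul_comm]
    have := norm_nonneg (z • (1 : Matrix (Fin d) (Fin d) ℂ) - B)⁻¹
    exact mul_le_mul (hC z hz) (hpK z hz) (norm_nonneg _) (this.trans (hC z hz))
  have hbound : ∀ N, ‖S N‖ ≤ Γ.length * (C * K) := fun N => by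
    rw [JordanContour.length, Finset.sum_mul]
    refine norm_sum_le_of_le _ fun i _ => ?_
    -- With `N = 0` there are no nodes, so the sign of `C * K` is read off at the starting point of
    -- the curve instead.
    by_cases hN : N = 0
    · subst hN
      have hz : (Γ.curve i).toFun 0 ∈ Γ.trace :=
        Set.mem_iUnion.2 ⟨i, 0, ⟨le_rfl, zero_le_one⟩, rfl⟩
      have := (norm_nonneg _).trans (hFle _ hz)
      simpa using mul_nonneg (show 0 ≤ (Γ.curve i).length from ENNReal.toReal_nonneg) this
    have hCK : 0 ≤ C * K := (norm_nonneg _).trans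
      (hFle _ (Γ.node_mem_trace i (Finset.mem_range.2 (Nat.pos_of_ne_zero hN))))
    calc _ ≤ ∑ l ∈ Finset.range N, ‖(Γ.curve i).toFun (((l + 1 : ℕ) : ℝ) / N) -
            (Γ.curve i).toFun ((l : ℝ) / N)‖ * (C * K) := by
          refine norm_sum_le_of_le _ fun l hl => ?_
          rw [norm_smul]
          exact mul_le_mul_of_nonneg_left (hFle _ (Γ.node_mem_trace i hl)) (norm_nonneg _)
      _ ≤ _ := by
          rw [← Finset.sum_mul]
          exact mul_le_mul_of_nonneg_right
            (sum_norm_sub_le_variation (Γ.curve i).rectifiable N) hCK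
  have := le_of_tendsto hlim.norm (Eventually.of_forall hbound)
  rw [norm_smul] at this
  have hpi : ‖2 * (Real.pi : ℂ) * Complex.I‖ = 2 * Real.pi := by
    simp [abs_of_pos Real.pi_pos]
  rw [hpi] at this
  rw [div_mul_eq_mul_div, div_mul_eq_mul_div, le_div_iff₀ (by positivity)]
  linarith

end JordanContour

/-! ### Spectral projectors commute with the matrix and sum to one -/

section SpectralProjector

variable {n : ℕ}

theorem continuousOn_resolvent (A : Matrix (Fin n) (Fin n) ℂ) :
    ContinuousOn (fun z : ℂ => (z • (1 : Matrix (Fin n) (Fin n) ℂ) - A)⁻¹) (spectrum ℂ A)ᶜ := by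
  intro z hz
  obtain ⟨u, hu⟩ := isUnit_smul_one_sub hz
  have h1 := NormedRing.inverse_continuousAt u
  rw [hu] at h1
  have h2 : ContinuousAt (fun z : ℂ => z • (1 : Matrix (Fin n) (Fin n) ℂ) - A) z := by fun_prop
  have h3 := ContinuousAt.comp (f := fun z : ℂ => z • (1 : Matrix (Fin n) (Fin n) ℂ) - A) h1 h2
  simp only [Matrix.nonsing_inv_eq_ringInverse]
  exact h3.continuousWithinAt

/-- The pairs of a function, integrable over each of the circles `C(l, r l)`, `l ∈ T`, and the sum of
its integrals. -/
def circlesRelation (T : Finset ℂ) (r : ℂ → ℝ) : Submodule ℂ ((ℂ → ℂ) × ℂ) where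
  carrier := {q | (∀ l ∈ T, CircleIntegrable q.1 l (r l)) ∧ ∑ l ∈ T, (∮ z in C(l, r l), q.1 z) = q.2}
  add_mem' := by
    rintro p q ⟨hp, hp'⟩ ⟨hq, hq'⟩
    refine ⟨fun l hl => (hp l hl).add (hq l hl), ?_⟩
    rw [Prod.snd_add, ← hp', ← hq', ← Finset.sum_add_distrib]
    exact Finset.sum_congr rfl fun l hl => circleIntegral.integral_add (hp l hl) (hq l hl)
  zero_mem' := by
    refine ⟨fun l _ => circleIntegrable_const 0 _ _, ?_⟩
    simp [circleIntegral]
  smul_mem' := by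
    rintro a q ⟨hq, hq'⟩
    refine ⟨fun l hl => (hq l hl).const_smul, ?_⟩
    rw [Prod.smul_snd, ← hq', Finset.smul_sum]
    exact Finset.sum_congr rfl fun l hl => circleIntegral.integral_const_mul a q.1 l (r l)

/-- Each circle winds once about its centre and not at all about the other points of `T`. -/
theorem isCycleIntegral_circles {T : Finset ℂ} {r : ℂ → ℝ}
    (hr : ∀ l ∈ T, 0 < r l ∧ ∀ μ ∈ T, μ ≠ l → r l < dist l μ) :
    IsCycleIntegral (circlesRelation T r) T (2 * (Real.pi : ℂ) * Complex.I) := by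
  have hoff : ∀ l ∈ T, ∀ a ∈ T, ∀ z ∈ Metric.sphere l (r l), z ≠ a := by
    rintro l hl a ha z hz rfl
    by_cases hzl : z = l
    · subst hzl
      have := (hr z hl).1
      simp at hz
      linarith
    · have := (hr l hl).2 z ha hzl
      rw [Metric.mem_sphere, dist_comm] at hz
      linarith
  have hcont : ∀ l ∈ T, ∀ a ∈ T, ContinuousOn (fun z => (z - a)⁻¹) (Metric.sphere l (r l)) :=
    fun l hl a ha => (continuousOn_id.sub continuousOn_const).inv₀
      fun z hz => sub_ne_zero.2 (hoff l hl a ha z hz)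
  refine ⟨?_, ?_, ?_⟩
  · rintro f g I hfg ⟨hf, hI⟩
    have hfg' : ∀ l ∈ T, Set.EqOn f g (Metric.sphere l (r l)) := fun l hl z hz =>
      hfg z fun hzT => hoff l hl z hzT z hz rfl
    refine ⟨fun l hl => (circleIntegrable_congr ?_).1 (hf l hl), ?_⟩
    · rw [abs_of_pos (hr l hl).1]; exact hfg' l hl
    · rw [← hI]
      exact Finset.sum_congr rfl fun l hl =>
        (circleIntegral.integral_congr (hr l hl).1.le (hfg' l hl)).symm
  · intro a ha
    refine ⟨fun l hl => (hcont l hl a ha).circleIntegrable (hr l hl).1.le, ?_⟩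
    rw [Finset.sum_eq_single_of_mem a ha]
    · exact circleIntegral.integral_sub_inv_of_mem_ball (Metric.mem_ball_self (hr a ha).1)
    · intro l hl hla
      refine Complex.circleIntegral_eq_zero_of_differentiable_on_off_countable (hr l hl).1.le
        Set.countable_empty ?_ ?_
      · refine (continuousOn_id.sub continuousOn_const).inv₀ fun z hz => sub_ne_zero.2 ?_
        rintro rfl
        rw [Metric.mem_closedBall, dist_comm] at hz
        exact absurd hz (not_le.2 ((hr l hl).2 _ ha (Ne.symm hla)))
      · rintro z ⟨hz, -⟩
        refine (differentiableAt_id.sub_const a).inv (sub_ne_zero.2 ?_)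
        rintro rfl
        rw [Metric.mem_ball, dist_comm] at hz
        exact absurd hz (not_lt.2 ((hr l hl).2 _ ha (Ne.symm hla)).le)
  · intro a ha k
    refine ⟨fun l hl => ((hcont l hl a ha).pow _).circleIntegrable (hr l hl).1.le, ?_⟩
    refine Finset.sum_eq_zero fun l _ => ?_
    have := circleIntegral.integral_sub_zpow_of_ne (n := -((k + 2 : ℕ) : ℤ)) (by omega) l a (r l)
    simpa only [zpow_neg, zpow_natCast, inv_pow] using this

theorem circleIntegrable_resolvent {A : Matrix (Fin n) (Fin n) ℂ} {l : ℂ} {R : ℝ} (hR : 0 < R)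
    (h : ∀ μ ∈ spectrum ℂ A, μ ≠ l → 2 * R < dist l μ) :
    CircleIntegrable (fun z => (z • (1 : Matrix (Fin n) (Fin n) ℂ) - A)⁻¹) l R := by
  refine ((continuousOn_resolvent A).mono fun z hz hzA => ?_).circleIntegrable hR.le
  rw [Metric.mem_sphere, dist_comm] at hz
  by_cases hzl : z = l
  · subst hzl
    simp at hz
    linarith
  · have := h z hzA hzl
    linarith

theorem circleIntegral_map {E F : Type*} [NormedAddCommGroup E] [NormedSpace ℂ E] [CompleteSpace E]
    [NormedAddCommGroup F] [NormedSpace ℂ F] [CompleteSpace F] (L : E →L[ℂ] F) {f : ℂ → E} {c : ℂ}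
    {R : ℝ} (hf : CircleIntegrable f c R) :
    (∮ z in C(c, R), L (f z)) = L (∮ z in C(c, R), f z) := by
  rw [circleIntegral, circleIntegral, ← L.intervalIntegral_comp_comm hf.out]
  simp

theorem IsSpectralProjector.commute {A P : Matrix (Fin n) (Fin n) ℂ} {Λ : Finset ℂ}
    (h : IsSpectralProjector A Λ P) : A * P = P * A := by
  obtain ⟨r, hr, rfl⟩ := h
  rw [Finset.mul_sum, Finset.sum_mul]
  refine Finset.sum_congr rfl fun l hl => ?_
  rw [mul_smul_comm, smul_mul_assoc]
  congr 1
  have hint := circleIntegrable_resolvent (hr l hl).1 (hr l hl).2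
  have h1 := circleIntegral_map (ContinuousLinearMap.mul ℂ (Matrix (Fin n) (Fin n) ℂ) A) hint
  have h2 := circleIntegral_map
    ((ContinuousLinearMap.mul ℂ (Matrix (Fin n) (Fin n) ℂ)).flip A) hint
  simp only [ContinuousLinearMap.mul_apply', ContinuousLinearMap.flip_apply] at h1 h2
  rw [← h1, ← h2]
  congr 1
  funext z
  have hc : Commute A (z • (1 : Matrix (Fin n) (Fin n) ℂ) - A) := by
    simp [Commute, SemiconjBy, mul_sub, sub_mul]
  rw [Matrix.nonsing_inv_eq_ringInverse]
  by_cases hu : IsUnit (z • (1 : Matrix (Fin n) (Fin n) ℂ) - A)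
  · obtain ⟨u, hu⟩ := hu
    rw [← hu] at hc ⊢
    rw [Ring.inverse_unit]
    exact hc.units_inv_right
  -- At a non-invertible value the inverse is `0` by convention, so the identity holds for every
  -- `z`.
  · rw [Ring.inverse_non_unit _ hu, mul_zero, zero_mul]

/-- All circles together form one cycle about the whole spectrum, over which the resolvent
integrates to `2πi`. -/
theorem sum_spectralProjector {m : ℕ} {A : Matrix (Fin n) (Fin n) ℂ} {Λ : Fin m → Finset ℂ}
    {P : Fin m → Matrix (Fin n) (Fin n) ℂ}
    (hdisj : ∀ i j, i ≠ j → Disjoint (Λ i) (Λ j))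
    (hunion : (⋃ j, (↑(Λ j) : Set ℂ)) = spectrum ℂ A)
    (hP : ∀ j, IsSpectralProjector A (Λ j) (P j)) : ∑ j, P j = 1 := by
  choose r hr hPr using hP
  set T : Finset ℂ := Finset.univ.biUnion Λ with hT
  have hTA : (T : Set ℂ) = spectrum ℂ A := by rw [← hunion]; simp [hT]
  -- By disjointness each point has one prescribed radius, so the radius functions glue; `0` is a
  -- dummy value elsewhere.
  have hex : ∀ l, ∃ ρ : ℝ, ∀ j, l ∈ Λ j → ρ = r j l := by
    intro l
    by_cases h : ∃ j, l ∈ Λ j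
    · obtain ⟨j, hj⟩ := h
      refine ⟨r j l, fun i hi => ?_⟩
      by_contra hne
      exact Finset.disjoint_left.1 (hdisj i j fun e => hne (by rw [e])) hi hj
    · exact ⟨0, fun j hj => absurd ⟨j, hj⟩ h⟩
  choose ρ hρ using hex
  have hρT : ∀ l ∈ T, 0 < ρ l ∧ ∀ μ ∈ spectrum ℂ A, μ ≠ l → 2 * ρ l < dist l μ := by
    intro l hl
    obtain ⟨j, -, hj⟩ := Finset.mem_biUnion.1 hl
    rw [hρ l j hj]
    exact hr j l hj
  have hcycle : IsCycleIntegral (circlesRelation T ρ) T (2 * (Real.pi : ℂ) * Complex.I) := by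
    refine isCycleIntegral_circles fun l hl => ⟨(hρT l hl).1, fun μ hμ hne => ?_⟩
    have h1 := (hρT l hl).2 μ (hTA ▸ hμ) hne
    have h2 := (hρT l hl).1
    linarith
  have hsum : ∑ j, P j = ∑ l ∈ T, (2 * (Real.pi : ℂ) * Complex.I)⁻¹ •
      ∮ z in C(l, ρ l), (z • (1 : Matrix (Fin n) (Fin n) ℂ) - A)⁻¹ := by
    rw [hT, Finset.sum_biUnion fun i _ j _ hij => hdisj i j hij]
    refine Finset.sum_congr rfl fun j _ => ?_
    rw [hPr j]
    exact Finset.sum_congr rfl fun l hl => by rw [hρ l j hl]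
  rw [hsum, ← Finset.smul_sum]
  have hmem := hcycle.resolvent (B := A) hTA.superset
  have hpi : 2 * (Real.pi : ℂ) * Complex.I ≠ 0 := Complex.two_pi_I_ne_zero
  rw [inv_smul_eq_iff₀ hpi]
  refine Matrix.ext fun a b => Eq.trans ?_ (hmem a b).2
  let L := (Matrix.entryLinearMap ℂ ℂ a b : Matrix (Fin n) (Fin n) ℂ →ₗ[ℂ] ℂ).toContinuousLinearMap
  refine (map_sum L _ T).trans (Finset.sum_congr rfl fun l hl => ?_)
  exact (circleIntegral_map L (circleIntegrable_resolvent (hρT l hl).1 (hρT l hl).2)).symm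

end SpectralProjector

/-! ### Attainment of the minimum -/

section Minimum

/-- Quotienting by the null space of `q` gives a finite-dimensional normed space, where the distance
from `-v` to a subspace is attained. Definiteness of `q` is thus not required. -/
theorem Seminorm.exists_forall_add_le {E : Type*} [AddCommGroup E] [Module ℂ E]
    [FiniteDimensional ℂ E] (q : Seminorm ℂ E) (W : Submodule ℂ E) (v : E) :
    ∃ w ∈ W, ∀ w' ∈ W, q (v + w) ≤ q (v + w') := by
  let : SeminormedAddCommGroup E := q.toAddGroupSeminorm.toSeminormedAddCommGroup
  let : NormedSpace ℂ E := ⟨fun a x => (map_smul_eq_mul q a x).le⟩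
  have hnorm : ∀ x : E, ‖x‖ = q x := fun _ => rfl
  let mk : E →ₗ[ℂ] SeparationQuotient E :=
    (SeparationQuotient.mkCLM ℂ E : E →L[ℂ] SeparationQuotient E).toLinearMap
  have hmk : ∀ x, ‖mk x‖ = q x := fun x => SeparationQuotient.norm_mk x
  have : FiniteDimensional ℂ (SeparationQuotient E) :=
    Module.Finite.of_surjective mk SeparationQuotient.surjective_mk
  have : ProperSpace (SeparationQuotient E) := FiniteDimensional.proper ℂ _
  obtain ⟨y, hy, hmin⟩ := (Submodule.closed_of_finiteDimensional (W.map mk)).exists_infDist_eq_dist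
    ⟨0, Submodule.zero_mem _⟩ (mk (-v))
  obtain ⟨w, hw, rfl⟩ := hy
  have hdist : ∀ u, dist (mk (-v)) (mk u) = q (v + u) := fun u => by
    rw [dist_eq_norm, ← map_sub, hmk, ← map_neg_eq_map q (v + u)]
    congr 1
    abel
  refine ⟨w, hw, fun w' hw' => ?_⟩
  rw [← hdist w, ← hdist w', ← hmin]
  exact Metric.infDist_le_dist_of_mem ⟨w', hw', rfl⟩

open Polynomial in
theorem exists_isLeast_image_residualPolys (q : Seminorm ℂ ℂ[X]) (k : ℕ) :
    ∃ μ : ℝ, IsLeast (q '' residualPolys k) μ := by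
  have hdeg : ∀ p : ℂ[X], p ∈ degreeLT ℂ (k + 1) ↔ p.natDegree ≤ k := fun p => by
    rw [mem_degreeLT, degree_lt_iff_coeff_zero, natDegree_le_iff_coeff_eq_zero]
    rfl
  have : FiniteDimensional ℂ (degreeLT ℂ (k + 1)) :=
    Module.Finite.equiv (degreeLTEquiv ℂ (k + 1)).symm
  -- The admissible polynomials form the affine space `1 + W`.
  let W : Submodule ℂ (degreeLT ℂ (k + 1)) :=
    LinearMap.ker ((leval (0 : ℂ)).comp (degreeLT ℂ (k + 1)).subtype)
  have hone : (1 : ℂ[X]) ∈ degreeLT ℂ (k + 1) := (hdeg 1).2 (by simp)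
  obtain ⟨w, hw, hmin⟩ := (q.comp (degreeLT ℂ (k + 1)).subtype).exists_forall_add_le W ⟨1, hone⟩
  have hw0 : (w : ℂ[X]).eval 0 = 0 := hw
  refine ⟨_, ⟨1 + w, ⟨?_, by simp [hw0]⟩, rfl⟩, ?_⟩
  · exact (hdeg _).1 (Submodule.add_mem _ hone w.2)
  · rintro _ ⟨p, ⟨hp, hp0⟩, rfl⟩
    have hpm : p - 1 ∈ degreeLT ℂ (k + 1) := Submodule.sub_mem _ ((hdeg p).2 hp) hone
    have := hmin ⟨p - 1, hpm⟩ (show (p - 1).eval 0 = 0 by simp [hp0])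
    simpa [Seminorm.comp_apply] using this

end Minimum

/-! ### Suprema of polynomials as seminorms -/

section SupAbs

variable {S : Set ℂ}

theorem bddAbove_norm_eval (hS : Bornology.IsBounded S) (p : Polynomial ℂ) :
    BddAbove ((fun z : ℂ => ‖p.eval z‖) '' S) := by
  have := (hS.isCompact_closure.image p.continuous.norm).bddAbove
  exact this.mono (Set.image_mono subset_closure)

theorem supAbs_nonneg (p : Polynomial ℂ) (S : Set ℂ) : 0 ≤ supAbs p S :=
  Real.sSup_nonneg (by rintro _ ⟨z, -, rfl⟩; exact norm_nonneg _)

/-- Continuity carries the bound to the closure, so a contour in the boundary of `S` costs nothing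
extra. -/
theorem norm_eval_le_supAbs (hS : Bornology.IsBounded S) (p : Polynomial ℂ) {z : ℂ}
    (hz : z ∈ closure S) : ‖p.eval z‖ ≤ supAbs p S :=
  closure_minimal (fun _ hw => le_csSup (bddAbove_norm_eval hS p) ⟨_, hw, rfl⟩)
    (isClosed_le p.continuous.norm continuous_const) hz

theorem supAbs_add_le (hS : Bornology.IsBounded S) (p q : Polynomial ℂ) :
    supAbs (p + q) S ≤ supAbs p S + supAbs q S := by
  refine Real.sSup_le ?_ (add_nonneg (supAbs_nonneg p S) (supAbs_nonneg q S))
  rintro _ ⟨z, hz, rfl⟩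
  simp only [Polynomial.eval_add]
  exact (norm_add_le _ _).trans (add_le_add (norm_eval_le_supAbs hS p (subset_closure hz))
    (norm_eval_le_supAbs hS q (subset_closure hz)))

theorem supAbs_smul (a : ℂ) (p : Polynomial ℂ) (S : Set ℂ) :
    supAbs (a • p) S = ‖a‖ * supAbs p S := by
  rw [supAbs, supAbs, ← smul_eq_mul, ← Real.sSup_smul_of_nonneg (norm_nonneg a),
    ← Set.image_smul, Set.image_image]
  simp

theorem JordanContour.length_nonneg (Γ : JordanContour) : 0 ≤ Γ.length :=
  Finset.sum_nonneg fun _ _ => ENNReal.toReal_nonneg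

theorem JordanContour.isBounded_trace (Γ : JordanContour) : Bornology.IsBounded Γ.trace :=
  (isCompact_iUnion fun i => isCompact_Icc.image_of_continuousOn (Γ.curve i).continuousOn).isBounded

/-- The sum of weighted suprema, as a seminorm on polynomials. -/
noncomputable def psaSeminorm {n m : ℕ} (P : Fin m → Matrix (Fin n) (Fin n) ℂ) {ε : ℝ} (hε : 0 < ε)
    (Γ : Fin m → JordanContour) {S : Fin m → Set ℂ} (hS : ∀ j, Bornology.IsBounded (S j)) :
    Seminorm ℂ (Polynomial ℂ) :=
  Seminorm.of (psaSum P ε Γ S)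
    (fun p q => by
      rw [psaSum, psaSum, psaSum, ← Finset.sum_add_distrib]
      refine Finset.sum_le_sum fun j _ => ?_
      rw [← mul_add]
      have := (Γ j).length_nonneg
      exact mul_le_mul_of_nonneg_left (supAbs_add_le (hS j) p q) (by positivity))
    (fun a p => by
      simp only [psaSum, supAbs_smul, Finset.mul_sum]
      exact Finset.sum_congr rfl fun j _ => mul_left_comm _ _ _)

end SupAbs

/-! ### Compression to an invariant subspace -/

section Compression

variable {n d : ℕ}

theorem exists_eq_mul_of_range_le {a b c : ℕ} {M : Matrix (Fin a) (Fin b) ℂ}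
    {N : Matrix (Fin a) (Fin c) ℂ}
    (h : LinearMap.range M.mulVecLin ≤ LinearMap.range N.mulVecLin) :
    ∃ W : Matrix (Fin c) (Fin b) ℂ, M = N * W := by
  have : ∀ j, ∃ w, N.mulVecLin w = M.mulVecLin (Pi.single j 1) := fun j => h ⟨_, rfl⟩
  choose w hw using this
  refine ⟨Matrix.of fun i j => w j i, ?_⟩
  ext i j
  have := congrFun (hw j) i
  simp only [Matrix.mulVecLin_apply, Matrix.mulVec_single_one, Matrix.col_apply] at this
  rw [← this]
  rfl

theorem aeval_mul_eq_mul_aeval {A : Matrix (Fin n) (Fin n) ℂ} {B : Matrix (Fin d) (Fin d) ℂ}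
    {U : Matrix (Fin n) (Fin d) ℂ} (h : A * U = U * B) (p : Polynomial ℂ) :
    Polynomial.aeval A p * U = U * Polynomial.aeval B p := by
  induction p using Polynomial.induction_on' with
  | add p q hp hq => rw [map_add, map_add, Matrix.add_mul, Matrix.mul_add, hp, hq]
  | monomial k a =>
    have hk : A ^ k * U = U * B ^ k := by
      induction k with
      | zero => simp
      | succ k ih => rw [pow_succ, Matrix.mul_assoc, h, ← Matrix.mul_assoc, ih, Matrix.mul_assoc,
          ← pow_succ]
    simp only [Polynomial.aeval_monomial, Algebra.algebraMap_eq_smul_one, smul_mul_assoc, one_mul,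
      Matrix.smul_mul, Matrix.mul_smul, hk]

theorem norm_le_one_of_conjTranspose_mul_self {U : Matrix (Fin n) (Fin d) ℂ}
    (hU : U.conjTranspose * U = 1) : ‖U‖ ≤ 1 := by
  have h := Matrix.l2_opNorm_conjTranspose_mul_self U
  -- Only an inequality, because `d = 0` is allowed.
  have h1 : ‖(1 : Matrix (Fin d) (Fin d) ℂ)‖ ≤ 1 := by
    rw [Matrix.cstar_norm_def, map_one]
    exact ContinuousLinearMap.norm_id_le
  rw [hU] at h
  nlinarith [norm_nonneg U]

/-- Commutation makes the common range invariant, and `U U*` fixes it; hence `p(A) P = U p(B) U* P`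
with `B = U* A U`, and `U`, `U*` are contractions. -/
theorem norm_aeval_mul_le {A P : Matrix (Fin n) (Fin n) ℂ} {U : Matrix (Fin n) (Fin d) ℂ}
    (hAP : A * P = P * A) (hU : U.conjTranspose * U = 1)
    (hrange : LinearMap.range U.mulVecLin = LinearMap.range P.mulVecLin) (p : Polynomial ℂ) :
    ‖Polynomial.aeval A p * P‖ ≤
      ‖Polynomial.aeval (U.conjTranspose * A * U) p‖ * ‖P‖ := by
  obtain ⟨V, hV⟩ := exists_eq_mul_of_range_le hrange.ge
  obtain ⟨W, hW⟩ := exists_eq_mul_of_range_le hrange.le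
  have hproj : ∀ {e : ℕ} (M : Matrix (Fin d) (Fin e) ℂ),
      U * (U.conjTranspose * (U * M)) = U * M := fun M => by
    rw [← Matrix.mul_assoc U.conjTranspose, hU, Matrix.one_mul]
  have hAU' : A * U = U * (V * (A * W)) := by
    calc A * U = A * P * W := by rw [Matrix.mul_assoc, ← hW]
      _ = _ := by rw [hAP, Matrix.mul_assoc, ← Matrix.mul_assoc U, ← hV]
  have hAU : A * U = U * (U.conjTranspose * A * U) := by
    rw [Matrix.mul_assoc U.conjTranspose, hAU', hproj]
  have hP : P = U * (U.conjTranspose * P) := by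
    conv_lhs => rw [hV]
    conv_rhs => rw [hV]
    exact (hproj V).symm
  have hU1 := norm_le_one_of_conjTranspose_mul_self hU
  have hU2 : ‖U.conjTranspose‖ ≤ 1 := by rwa [Matrix.l2_opNorm_conjTranspose]
  calc ‖Polynomial.aeval A p * P‖
      = ‖U * (Polynomial.aeval (U.conjTranspose * A * U) p * (U.conjTranspose * P))‖ := by
        conv_lhs => rw [hP]
        rw [← Matrix.mul_assoc, aeval_mul_eq_mul_aeval hAU, Matrix.mul_assoc]
    _ ≤ ‖U‖ * (‖Polynomial.aeval (U.conjTranspose * A * U) p‖ * (‖U.conjTranspose‖ * ‖P‖)) :=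
        (Matrix.l2_opNorm_mul _ _).trans <| mul_le_mul_of_nonneg_left
          ((Matrix.l2_opNorm_mul _ _).trans <| mul_le_mul_of_nonneg_left
            (Matrix.l2_opNorm_mul _ _) (norm_nonneg _)) (norm_nonneg _)
    _ ≤ 1 * (‖Polynomial.aeval (U.conjTranspose * A * U) p‖ * (1 * ‖P‖)) := by gcongr
    _ = _ := by rw [one_mul, one_mul]

theorem isBounded_pseudospectrum {ε : ℝ} (hε : 0 < ε) (B : Matrix (Fin d) (Fin d) ℂ) :
    Bornology.IsBounded (pseudospectrum ε B) := by
  have h1 : ∀ᶠ z in Bornology.cobounded ℂ, ‖resolvent B z‖ < ε⁻¹ := by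
    have := (spectrum.resolvent_tendsto_cobounded (𝕜 := ℂ) B).norm
    rw [norm_zero] at this
    exact this.eventually_lt_const (inv_pos.2 hε)
  have h2 : ∀ᶠ z in Bornology.cobounded ℂ, z ∉ spectrum ℂ B :=
    Bornology.isBounded_def.1 (spectrum.isBounded (𝕜 := ℂ) B)
  rw [← Bornology.isCobounded_compl_iff, Bornology.isCobounded_def]
  filter_upwards [h1, h2] with z hz1 hz2 hz
  rcases hz with hz | hz
  · exact hz2 hz
  · rw [resolvent, Algebra.algebraMap_eq_smul_one, ← Matrix.nonsing_inv_eq_ringInverse] at hz1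
    exact lt_asymm hz1 hz

/-- The contour avoids the pseudospectrum, so the resolvent norm on it is at most `ε⁻¹`. -/
theorem norm_aeval_le_of_encloses_pseudospectrum {ε : ℝ} {B : Matrix (Fin d) (Fin d) ℂ}
    {Γ : JordanContour} (h : Γ.Encloses (pseudospectrum ε B)) {S : Set ℂ}
    (hS : Bornology.IsBounded S) (hΓS : Γ.trace ⊆ closure S) (p : Polynomial ℂ) :
    ‖Polynomial.aeval B p‖ ≤ Γ.length / (2 * Real.pi * ε) * supAbs p S := by
  have hspec : spectrum ℂ B ⊆ pseudospectrum ε B := fun z hz => Or.inl hz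
  refine ((h.mono hspec).norm_aeval_le (C := ε⁻¹) (fun z hz => ?_) p
    fun z hz => norm_eval_le_supAbs hS p (hΓS hz)).trans_eq ?_
  · exact not_lt.1 fun hlt => Set.disjoint_left.1 h.disjoint_trace (Or.inr hlt) hz
  · rw [← div_div _ _ ε, div_eq_mul_inv _ ε]

end Compression

/-! ### The residual polynomial bound for GMRES -/

section GMRES

variable {n : ℕ}

theorem matVec_eq_toEuclideanCLM (A : Matrix (Fin n) (Fin n) ℂ) (x : EuclideanSpace ℂ (Fin n)) :
    matVec A x = Matrix.toEuclideanCLM (n := Fin n) (𝕜 := ℂ) A x := rfl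

theorem norm_matVec_le (A : Matrix (Fin n) (Fin n) ℂ) (x : EuclideanSpace ℂ (Fin n)) :
    ‖matVec A x‖ ≤ ‖A‖ * ‖x‖ :=
  (Matrix.toEuclideanCLM (n := Fin n) (𝕜 := ℂ) A).le_opNorm x

open Polynomial in
theorem matVec_aeval_mem_krylov (A : Matrix (Fin n) (Fin n) ℂ) (r : EuclideanSpace ℂ (Fin n))
    {k : ℕ} {q : ℂ[X]} (hq : ∀ i ∈ q.support, i < k) : matVec (aeval A q) r ∈ krylov A r k := by
  rw [aeval_eq_sum_range, matVec_eq_toEuclideanCLM, map_sum, sum_apply]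
  refine Submodule.sum_mem _ fun i _ => ?_
  rw [map_smul, smul_apply]
  by_cases hi : i ∈ q.support
  · exact Submodule.smul_mem _ _ (Submodule.subset_span ⟨i, hq i hi, rfl⟩)
  · rw [notMem_support_iff.1 hi, zero_smul]
    exact Submodule.zero_mem _

open Polynomial in
theorem IsGMRESIterate.norm_residual_le {A : Matrix (Fin n) (Fin n) ℂ}
    {b x₀ x : EuclideanSpace ℂ (Fin n)} {k : ℕ} (hx : IsGMRESIterate A b x₀ k x) {p : ℂ[X]}
    (hp : p ∈ residualPolys k) :
    ‖axResidual A b x‖ ≤ ‖matVec (aeval A p) (axResidual A b x₀)‖ := by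
  obtain ⟨hdeg, h0⟩ := hp
  set r := axResidual A b x₀ with hr
  have hmem : matVec (aeval A p.divX) r ∈ krylov A r k := by
    refine matVec_aeval_mem_krylov A r fun i hi => ?_
    rw [mem_support_iff, coeff_divX] at hi
    exact Nat.lt_of_succ_le ((le_natDegree_of_ne_zero hi).trans hdeg)
  -- Writing `p = X q + 1` with `q = p.divX`, the competitor `x₀ - q(A) r` has residual `r + A q(A)
  -- r = p(A) r`.
  refine (hx.2 (x₀ - matVec (aeval A p.divX) r) ?_).trans_eq ?_
  · rw [sub_sub_cancel_left]
    exact Submodule.neg_mem _ hmem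
  · congr 1
    have hpA : aeval A p = A * aeval A p.divX + 1 := by
      conv_lhs => rw [← X_mul_divX_add p, coeff_zero_eq_eval_zero, h0]
      simp
    rw [hpA, axResidual]
    simp only [matVec_eq_toEuclideanCLM, map_add, map_mul, map_one, map_sub,
      add_apply, mul_apply_eq_comp, one_apply_eq_self]
    rw [hr, axResidual]
    simp only [matVec_eq_toEuclideanCLM, map_sub]
    abel

end GMRES

/-! ### Assembly of the bounds -/

/-- Both parts are instances: all that matters about `S j` is that it is bounded and its closure
contains the contour. The residual bound is applied at a minimizing polynomial. -/
theorem exists_isLeast_psaSum_and_residual_le {n : ℕ} {A : Matrix (Fin n) (Fin n) ℂ}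
    {b x₀ : EuclideanSpace ℂ (Fin n)} (hr₀ : axResidual A b x₀ ≠ 0)
    {k : ℕ} {x : EuclideanSpace ℂ (Fin n)} (hx : IsGMRESIterate A b x₀ k x)
    {m : ℕ} {P : Fin m → Matrix (Fin n) (Fin n) ℂ}
    (hAP : ∀ j, A * P j = P j * A) (hsum : ∑ j, P j = 1)
    {d : Fin m → ℕ} {U : (j : Fin m) → Matrix (Fin n) (Fin (d j)) ℂ}
    (hUorth : ∀ j, (U j).conjTranspose * U j = 1)
    (hUrange : ∀ j, LinearMap.range (U j).mulVecLin = LinearMap.range (P j).mulVecLin)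
    {ε : ℝ} (hε : 0 < ε) {Γ : Fin m → JordanContour}
    (hΓ : ∀ j, (Γ j).Encloses (pseudospectrum ε ((U j).conjTranspose * A * U j)))
    {S : Fin m → Set ℂ} (hS : ∀ j, Bornology.IsBounded (S j))
    (hΓS : ∀ j, (Γ j).trace ⊆ closure (S j)) :
    ∃ μ : ℝ, IsLeast (psaSum P ε Γ S '' residualPolys k) μ ∧
      ‖axResidual A b x‖ / ‖axResidual A b x₀‖ ≤ μ := by
  obtain ⟨μ, hμ⟩ := exists_isLeast_image_residualPolys (psaSeminorm P hε Γ hS) k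
  refine ⟨μ, hμ, ?_⟩
  obtain ⟨p, hp, rfl⟩ := hμ.1
  rw [div_le_iff₀ (norm_pos_iff.2 hr₀)]
  refine (hx.norm_residual_le hp).trans ((norm_matVec_le _ _).trans ?_)
  refine mul_le_mul_of_nonneg_right ?_ (norm_nonneg _)
  calc ‖Polynomial.aeval A p‖ = ‖∑ j, Polynomial.aeval A p * P j‖ := by
        rw [← Finset.mul_sum, hsum, mul_one]
    _ ≤ psaSum P ε Γ S p := by
        refine norm_sum_le_of_le _ fun j _ => ?_
        refine (norm_aeval_mul_le (hAP j) (hUorth j) (hUrange j) p).trans ?_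
        rw [mul_comm, mul_assoc]
        exact mul_le_mul_of_nonneg_left
          (norm_aeval_le_of_encloses_pseudospectrum (hΓ j) (hS j) (hΓS j) p) (norm_nonneg _)

theorem mainTheorem5 {n : ℕ} (A : Matrix (Fin n) (Fin n) ℂ)
    (b x₀ : EuclideanSpace ℂ (Fin n)) (hr₀ : axResidual A b x₀ ≠ 0)
    (k : ℕ) (x : EuclideanSpace ℂ (Fin n)) (hx : IsGMRESIterate A b x₀ k x)
    (m : ℕ) (Λ : Fin m → Finset ℂ)
    (hdisj : ∀ i j, i ≠ j → Disjoint (Λ i) (Λ j))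
    (hunion : (⋃ j, (↑(Λ j) : Set ℂ)) = spectrum ℂ A)
    (P : Fin m → Matrix (Fin n) (Fin n) ℂ)
    (hP : ∀ j, IsSpectralProjector A (Λ j) (P j))
    (d : Fin m → ℕ) (U : (j : Fin m) → Matrix (Fin n) (Fin (d j)) ℂ)
    (hUorth : ∀ j, (U j).conjTranspose * U j = 1)
    (hUrange : ∀ j, LinearMap.range (U j).mulVecLin = LinearMap.range (P j).mulVecLin)
    (ε : ℝ) (hε : 0 < ε) (Γ : Fin m → JordanContour)
    (hΓ : ∀ j, (Γ j).Encloses (pseudospectrum ε ((U j).conjTranspose * A * U j))) :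
    ((∀ j, (Γ j).trace ⊆ frontier (pseudospectrum ε ((U j).conjTranspose * A * U j))) →
      ∃ μ : ℝ,
        IsLeast (psaSum P ε Γ (fun j => pseudospectrum ε ((U j).conjTranspose * A * U j)) ''
          residualPolys k) μ ∧
        ‖axResidual A b x‖ / ‖axResidual A b x₀‖ ≤ μ) ∧
    ∃ μ : ℝ,
      IsLeast (psaSum P ε Γ
        (fun j => pseudospectrum ε ((U j).conjTranspose * A * U j) ∪ (Γ j).trace) ''
          residualPolys k) μ ∧
      ‖axResidual A b x‖ / ‖axResidual A b x₀‖ ≤ μ := by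
  have hAP := fun j => (hP j).commute
  have hsum := sum_spectralProjector hdisj hunion hP
  have hbdd := fun j => isBounded_pseudospectrum hε ((U j).conjTranspose * A * U j)
  refine ⟨fun hfr => ?_, ?_⟩
  · exact exists_isLeast_psaSum_and_residual_le hr₀ hx hAP hsum hUorth hUrange hε hΓ hbdd
      fun j => (hfr j).trans frontier_subset_closure
  · exact exists_isLeast_psaSum_and_residual_le hr₀ hx hAP hsum hUorth hUrange hε hΓ
      (fun j => (hbdd j).union (Γ j).isBounded_trace)
      fun j => Set.subset_union_right.trans subset_closure
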